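/- Let $\Bbbk$ be a field and let $a,b,c\ge 0$ be integers. Let $L(a,b,c)$ be the graph with vertex set $\{x,y\}\cup\{x_i\}_{i=1}^a\cup\{y_j\}_{j=1}^b\cup\{z_k\}_{k=1}^c$ and edge set $\{\{x,y\}\}\cup\{\{x,x_i\}\}_{i=1}^a\cup\{\{y,y_j\}\}_{j=1}^b\cup\{\{x,z_k\},\{y,z_k\}\}_{k=1}^c$. Let $Q$ be the polynomial ring over $\Bbbk$ whose variables are the vertices of $L(a,b,c)$, and let $I_{L(a,b,c)}\subseteq Q$ be its edge ideal, generated by the products $uw$ over all edges $\{u,w\}$. Then $Q/I_{L(a,b,c)}$ has a graded minimal free resolution by free $Q$-modules of finite rank. In every minimal free resolution $F$ of $Q/I_{L(a,b,c)}$ (that is, every resolution by free modules of finite rank with $\partial(F_{i+1})\subseteq\mathfrak m F_i$ for all $i \ge 0$, where $\mathfrak m$ is the ideal generated by the variables), the rank of $F_i$, i.e. the $i$th Betti number of $Q/I_{L(a,b,c)}$, is \[ \beta_i^Q=\begin{cases}1,& i=0,\\ a+b+2c+1,& i=1,\\ \binom{a+c+1}{i}+\binom{b+c+1}{i},& i\ge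 2.\end{cases} \] Moreover, the projective dimension of $Q/I_{L(a,b,c)}$ over $Q$ is $\max(a+c+1,\,b+c+1)$. -/

import Mathlib

universe u v

open CategoryTheory

/-- The vertices `x`, `y`, `x₁, …, x_a`, `y₁, …, y_b`, `z₁, …, z_c` of `L(a,b,c)`. -/
inductive LVertex (a b c : ℕ) : Type
  | x : LVertex a b c
  | y : LVertex a b c
  | xs (i : Fin a) : LVertex a b c
  | ys (j : Fin b) : LVertex a b c
  | zs (k : Fin c) : LVertex a b c

/-- The Lyubeznik graph `L(a,b,c)`. -/
def lyubeznikGraph (a b c : ℕ) : SimpleGraph (LVertex a b c) :=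
  SimpleGraph.fromEdgeSet
    ({s(LVertex.x, LVertex.y)}
      ∪ Set.range (fun i : Fin a => s(LVertex.x, LVertex.xs i))
      ∪ Set.range (fun j : Fin b => s(LVertex.y, LVertex.ys j))
      ∪ (Set.range (fun k : Fin c => s(LVertex.x, LVertex.zs k))
        ∪ Set.range (fun k : Fin c => s(LVertex.y, LVertex.zs k))))

/-- The edge ideal of a graph `G` in the polynomial ring over `𝕜` whose variables are the
vertices of `G`. -/
noncomputable def edgeIdeal (𝕜 : Type u) [Field 𝕜] {V : Type v} (G : SimpleGraph V) :
    Ideal (MvPolynomial V 𝕜) :=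
  Ideal.span {m | ∃ u w : V, G.Adj u w ∧ m = MvPolynomial.X u * MvPolynomial.X w}

/-- The quotient `Q / I` of a polynomial ring `Q`, as a `Q`-module. -/
noncomputable abbrev quotientModule {𝕜 : Type u} [Field 𝕜] {V : Type v} (I : Ideal (MvPolynomial V 𝕜)) :
    ModuleCat.{max v u} (MvPolynomial V 𝕜) :=
  ModuleCat.of (MvPolynomial V 𝕜) (MvPolynomial V 𝕜 ⧸ I)

/-- A resolution `⋯ → F₂ → F₁ → F₀ → M → 0` over the polynomial ring `Q` is a minimal free
resolution (by free modules of finite rank) if every `F_i` is free of finite rank and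
`∂(F_{i+1}) ⊆ 𝔪 F_i`, where `𝔪` is the ideal generated by the variables. -/
structure IsMinimalFree {𝕜 : Type u} [Field 𝕜] {V : Type v}
    {M : ModuleCat.{max v u} (MvPolynomial V 𝕜)} (F : ProjectiveResolution M) : Prop where
  free : ∀ i, Module.Free (MvPolynomial V 𝕜) (F.complex.X i)
  finite : ∀ i, Module.Finite (MvPolynomial V 𝕜) (F.complex.X i)
  minimal : ∀ i, LinearMap.range (F.complex.d (i + 1) i).hom ≤
    Ideal.span (Set.range (MvPolynomial.X : V → MvPolynomial V 𝕜)) •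
      (⊤ : Submodule (MvPolynomial V 𝕜) (F.complex.X i))

/-- The augmentation `F₀ → M` of a resolution of `M`. -/
noncomputable def augmentation {R : Type u} [CommRing R] {M : ModuleCat.{v} R}
    (F : ProjectiveResolution M) : F.complex.X 0 →ₗ[R] M :=
  (F.π.f 0 ≫ (HomologicalComplex.singleObjXSelf (ComplexShape.down ℕ) 0 M).hom).hom

/-- A resolution of `Q / I` by free modules of finite rank is graded (for the standard grading
of `Q`) if the free modules have bases whose elements can be given integer degrees such that all
differentials, and the augmentation `F₀ → Q / I`, are homogeneous of degree zero. -/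
def IsGradedFree {𝕜 : Type u} [Field 𝕜] {V : Type v} {I : Ideal (MvPolynomial V 𝕜)}
    (F : ProjectiveResolution (quotientModule I)) : Prop :=
  ∃ (r : ℕ → ℕ) (B : ∀ i, Module.Basis (Fin (r i)) (MvPolynomial V 𝕜) (F.complex.X i))
    (δ : ∀ i, Fin (r i) → ℤ),
    (∀ i p q, (B i).repr ((F.complex.d (i + 1) i).hom (B (i + 1) q)) p ≠ 0 →
      ∃ e : ℕ, ((B i).repr ((F.complex.d (i + 1) i).hom (B (i + 1) q)) p).IsHomogeneous e ∧
        δ i p + e = δ (i + 1) q) ∧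
    (∀ q, augmentation F (B 0 q) ≠ 0 →
      ∃ (e : ℕ) (p : MvPolynomial V 𝕜), p.IsHomogeneous e ∧ (e : ℤ) = δ 0 q ∧
        augmentation F (B 0 q) = Ideal.Quotient.mk I p)

/-! Write `l` for the variables x_i, z_k and `m` for the variables y_j, z_k. The edge ideal is x·(y,
l) + y·(x, m), and the two summands meet exactly in (xy): if x·p + y·q = 0, then y divides p and x
divides q. Up to a shift, each summand is an ideal generated by distinct variables, so the positive
part of a Koszul complex resolves it. The intersection (xy) is free of rank one, and its only effect
is to identify the basis element of y in the first complex with that of x in the second, since both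
map to xy. The glued complex therefore has one generator less than the direct sum in degree 1 and
agrees with it from degree 2 on, which gives the stated ranks.

Exactness is `exists_of_gluedD_eq_zero`, built on the Koszul case `exists_of_koszulD_eq_zero`. All
matrix entries are homogeneous of positive degree (`gluedD_raisesDegree`), so the resolution is
minimal and graded. `IsMinimalFree.finrank_eq` transfers the ranks to every minimal free resolution,
and `IsMinimalFree.hasProjectiveDimensionLT_iff` reads the projective dimension off them. -/

open MvPolynomial

/-! ### Koszul complexes on lists of variables, as iterated mapping cones -/

/-- The basis elements in degree `i` of the Koszul complex on a list of variables. -/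
def KoszulIndex {V : Type v} : List V → ℕ → Type
  | [], 0 => Unit
  | [], _ + 1 => Empty
  | _ :: l, 0 => KoszulIndex l 0
  | _ :: l, i + 1 => KoszulIndex l (i + 1) ⊕ KoszulIndex l i

namespace KoszulIndex

noncomputable instance fintype {V : Type v} : (l : List V) → (i : ℕ) → Fintype (KoszulIndex l i)
  | [], 0 => inferInstanceAs (Fintype Unit)
  | [], _ + 1 => inferInstanceAs (Fintype Empty)
  | _ :: l, 0 => fintype l 0
  | _ :: l, i + 1 =>
    letI := fintype l (i + 1)
    letI := fintype l i
    inferInstanceAs (Fintype (KoszulIndex l (i + 1) ⊕ KoszulIndex l i))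

instance unique {V : Type v} : (l : List V) → Unique (KoszulIndex l 0)
  | [] => inferInstanceAs (Unique Unit)
  | _ :: l => unique l

lemma card_eq {V : Type v} : ∀ (l : List V) (i : ℕ),
    Nat.card (KoszulIndex l i) = l.length.choose i
  | l, 0 => by simp
  | [], i + 1 => by simp [KoszulIndex]
  | _ :: l, i + 1 => by
    rw [KoszulIndex, Nat.card_sum, card_eq, card_eq, List.length_cons, Nat.choose_succ_succ,
      add_comm]

end KoszulIndex

section Koszul

variable {𝕜 : Type u} [Field 𝕜] {V : Type v}

/-- The last differential of the mapping cone of multiplication by `f`. -/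
def coneZero {R : Type*} [CommRing R] {α β : Type*} (f : R) (T : (α → R) →ₗ[R] (β → R)) :
    (α ⊕ β → R) →ₗ[R] (β → R) where
  toFun u := T (u ∘ Sum.inl) + f • (u ∘ Sum.inr)
  map_add' a b := by
    rw [Pi.add_comp, Pi.add_comp, map_add, smul_add]; abel
  map_smul' r a := by
    rw [Pi.smul_comp, Pi.smul_comp, map_smul, RingHom.id_apply, smul_add, smul_comm f r]

/-- The differentials, except the last one, of the mapping cone of multiplication by `f`. -/
def coneSucc {R : Type*} [CommRing R] {α β γ : Type*} (f : R) (T : (α → R) →ₗ[R] (β → R))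
    (S : (β → R) →ₗ[R] (γ → R)) : (α ⊕ β → R) →ₗ[R] (β ⊕ γ → R) where
  toFun u := Sum.elim (T (u ∘ Sum.inl) + f • (u ∘ Sum.inr)) (-(S (u ∘ Sum.inr)))
  map_add' a b := by
    funext p
    rcases p with p | p <;> simp [Pi.add_comp] <;> ring
  map_smul' r a := by
    funext p
    rcases p with p | p <;> simp [Pi.smul_comp]; ring

/-- The differential of the Koszul complex on a list of variables. -/
noncomputable def koszulD (𝕜 : Type u) [Field 𝕜] {V : Type v} : (l : List V) → (i : ℕ) →
    (KoszulIndex l (i + 1) → MvPolynomial V 𝕜) →ₗ[MvPolynomial V 𝕜]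
      (KoszulIndex l i → MvPolynomial V 𝕜)
  | [], _ => 0
  | v :: l, 0 => coneZero (X v) (koszulD 𝕜 l 0)
  | v :: l, i + 1 => coneSucc (X v) (koszulD 𝕜 l (i + 1)) (koszulD 𝕜 l i)

lemma koszulD_cons_zero (v : V) (l : List V)
    (a : KoszulIndex l 1 → MvPolynomial V 𝕜) (b : KoszulIndex l 0 → MvPolynomial V 𝕜) :
    koszulD 𝕜 (v :: l) 0 (Sum.elim a b) = koszulD 𝕜 l 0 a + (X v : MvPolynomial V 𝕜) • b := rfl

lemma koszulD_cons_succ (v : V) (l : List V) (i : ℕ)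
    (a : KoszulIndex l (i + 2) → MvPolynomial V 𝕜)
    (b : KoszulIndex l (i + 1) → MvPolynomial V 𝕜) :
    koszulD 𝕜 (v :: l) (i + 1) (Sum.elim a b) =
      Sum.elim (koszulD 𝕜 l (i + 1) a + (X v : MvPolynomial V 𝕜) • b) (-(koszulD 𝕜 l i b)) := rfl

lemma exists_sumElim {α β γ : Type*} (u : α ⊕ β → γ) : ∃ a b, u = Sum.elim a b :=
  ⟨u ∘ Sum.inl, u ∘ Sum.inr, (Sum.elim_comp_inl_inr u).symm⟩

lemma koszulD_comp_koszulD : ∀ (l : List V) (i : ℕ) (u : KoszulIndex l (i + 2) → MvPolynomial V 𝕜),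
    koszulD 𝕜 l i (koszulD 𝕜 l (i + 1) u) = 0
  | [], _, _ => rfl
  | v :: l, 0, u => by
    obtain ⟨a, b, rfl⟩ := exists_sumElim u
    rw [koszulD_cons_succ, koszulD_cons_zero, map_add, koszulD_comp_koszulD, map_smul]
    simp
    rfl
  | v :: l, i + 1, u => by
    obtain ⟨a, b, rfl⟩ := exists_sumElim u
    rw [koszulD_cons_succ, koszulD_cons_succ, map_add, koszulD_comp_koszulD, map_smul, map_neg,
      koszulD_comp_koszulD]
    funext p
    rcases p with p | p <;> simp <;> rfl

lemma mem_range_koszulD_zero : ∀ (l : List V) (w : KoszulIndex l 0 → MvPolynomial V 𝕜),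
    w ∈ LinearMap.range (koszulD 𝕜 l 0) ↔
      w default ∈ Ideal.span (X '' {v | v ∈ l} : Set (MvPolynomial V 𝕜))
  | [], w => by
    have : koszulD 𝕜 ([] : List V) 0 = 0 := rfl
    rw [this]
    simp only [LinearMap.range_zero, Submodule.mem_bot, List.not_mem_nil, Set.ofPred_false,
      Set.image_empty, Ideal.span_empty]
    constructor
    · rintro rfl; rfl
    · intro h; funext p; rw [Subsingleton.elim p default, h]; rfl
  | v :: l, w => by
    have hs : (X '' {w | w ∈ v :: l} : Set (MvPolynomial V 𝕜)) =
        {X v} ∪ X '' {w | w ∈ l} := by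
      ext p; simp [eq_comm]
    rw [hs, Ideal.span_union, Submodule.mem_sup]
    constructor
    · rintro ⟨u, rfl⟩
      obtain ⟨a, b, rfl⟩ := exists_sumElim u
      rw [koszulD_cons_zero]
      refine ⟨X v * b default, Ideal.mul_mem_right _ _ (Ideal.subset_span rfl), _,
        (mem_range_koszulD_zero l (koszulD 𝕜 l 0 a)).1 ⟨a, rfl⟩, ?_⟩
      rw [add_comm]; rfl
    · rintro ⟨p, hp, q, hq, h⟩
      obtain ⟨b, rfl⟩ := Ideal.mem_span_singleton.1 hp
      obtain ⟨a, ha⟩ := (mem_range_koszulD_zero l (fun _ => q)).2 hq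
      refine ⟨Sum.elim a (fun _ => b), ?_⟩
      rw [koszulD_cons_zero, ha]
      funext e
      rw [Unique.eq_default e]
      exact (add_comm _ _).trans h

/-- Membership in an ideal of variables is tested monomial by monomial, and multiplying by a
variable outside `s` does not create divisibility by one in `s`. This is the regular sequence
property that drives Koszul exactness. -/
lemma mem_span_X_of_X_mul_mem {s : Set V} {v : V} (hv : v ∉ s) {b : MvPolynomial V 𝕜}
    (h : X v * b ∈ Ideal.span (X '' s : Set (MvPolynomial V 𝕜))) :
    b ∈ Ideal.span (X '' s : Set (MvPolynomial V 𝕜)) := by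
  rw [mem_ideal_span_X_image] at h ⊢
  intro m hm
  obtain ⟨i, hi, hmi⟩ := h (Finsupp.single v 1 + m) (by
    rw [mem_support_iff] at hm ⊢
    rwa [coeff_X_mul])
  refine ⟨i, hi, ?_⟩
  have : v ≠ i := fun e => hv (e ▸ hi)
  simpa [Finsupp.single_apply, this] using hmi

/-- Induction on the list through the mapping cone: the second component `b` of a cycle is a
boundary `D c`, and then `a + X v • c` is a cycle of the shorter complex. In the lowest degree `b`
is a boundary because X_v is regular modulo the remaining variables. -/
lemma exists_of_koszulD_eq_zero : ∀ (l : List V) (_ : l.Nodup) (i : ℕ)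
    (u : KoszulIndex l (i + 1) → MvPolynomial V 𝕜), koszulD 𝕜 l i u = 0 →
    ∃ w, koszulD 𝕜 l (i + 1) w = u
  | [], _, i, u, _ => ⟨0, funext fun p => p.elim⟩
  | v :: l, hl, 0, u, hu => by
    obtain ⟨a, b, rfl⟩ := exists_sumElim u
    rw [koszulD_cons_zero] at hu
    obtain ⟨hv, hl⟩ := List.nodup_cons.1 hl
    have hb : b ∈ LinearMap.range (koszulD 𝕜 l 0) := by
      rw [mem_range_koszulD_zero]
      apply mem_span_X_of_X_mul_mem (v := v) hv
      refine (mem_range_koszulD_zero l ((X v : MvPolynomial V 𝕜) • b)).1 ⟨-a, ?_⟩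
      rw [map_neg]
      exact neg_eq_of_add_eq_zero_right hu
    obtain ⟨c, rfl⟩ := hb
    obtain ⟨d, hd⟩ := exists_of_koszulD_eq_zero l hl 0 (a + (X v : MvPolynomial V 𝕜) • c)
      (by rw [map_add, map_smul]; exact hu)
    -- The sign of `c` cancels the sign in the second block of `coneSucc`.
    refine ⟨Sum.elim d (-c), ?_⟩
    rw [koszulD_cons_succ, hd, map_neg, smul_neg, neg_neg, add_neg_cancel_right]
  | v :: l, hl, i + 1, u, hu => by
    obtain ⟨a, b, rfl⟩ := exists_sumElim u
    rw [koszulD_cons_succ] at hu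
    obtain ⟨hv, hl⟩ := List.nodup_cons.1 hl
    have h1 : koszulD 𝕜 l (i + 1) a + (X v : MvPolynomial V 𝕜) • b = 0 :=
      funext fun p => congrFun hu (Sum.inl p)
    have h2 : koszulD 𝕜 l i b = 0 :=
      funext fun p => neg_eq_zero.1 (congrFun hu (Sum.inr p))
    obtain ⟨c, rfl⟩ := exists_of_koszulD_eq_zero l hl i b h2
    obtain ⟨d, hd⟩ := exists_of_koszulD_eq_zero l hl (i + 1) (a + (X v : MvPolynomial V 𝕜) • c)
      (by rw [map_add, map_smul]; exact h1)
    refine ⟨Sum.elim d (-c), ?_⟩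
    rw [koszulD_cons_succ, hd, map_neg, smul_neg, neg_neg, add_neg_cancel_right]

/-- A linear map between free modules raises polynomial degrees by `e`. -/
def RaisesDegree {ι κ : Type} (e : ℕ)
    (T : (ι → MvPolynomial V 𝕜) →ₗ[MvPolynomial V 𝕜] (κ → MvPolynomial V 𝕜)) : Prop :=
  ∀ (d : ℕ) (u : ι → MvPolynomial V 𝕜), (∀ q, (u q).IsHomogeneous d) →
    ∀ p, (T u p).IsHomogeneous (d + e)

lemma koszulD_raisesDegree : ∀ (l : List V) (i : ℕ), RaisesDegree 1 (koszulD 𝕜 l i)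
  | [], _, d, u, _, p => isHomogeneous_zero _ _ _
  | v :: l, 0, d, u, hu, p => by
    obtain ⟨a, b, rfl⟩ := exists_sumElim u
    rw [koszulD_cons_zero]
    refine (koszulD_raisesDegree l 0 d a (fun q => hu (Sum.inl q)) p).add ?_
    rw [add_comm d]
    exact (isHomogeneous_X _ _).mul (hu (Sum.inr p))
  | v :: l, i + 1, d, u, hu, p => by
    obtain ⟨a, b, rfl⟩ := exists_sumElim u
    rw [koszulD_cons_succ]
    rcases p with p | p
    · refine (koszulD_raisesDegree l (i + 1) d a (fun q => hu (Sum.inl q)) p).add ?_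
      rw [add_comm d]
      exact (isHomogeneous_X _ _).mul (hu (Sum.inr p))
    · exact (koszulD_raisesDegree l i d b (fun q => hu (Sum.inr q)) p).neg

lemma RaisesDegree.isHomogeneous_single {ι κ : Type} [DecidableEq ι] {e : ℕ}
    {T : (ι → MvPolynomial V 𝕜) →ₗ[MvPolynomial V 𝕜] (κ → MvPolynomial V 𝕜)}
    (hT : RaisesDegree e T) (q : ι) (p : κ) : (T (Pi.single q 1) p).IsHomogeneous e := by
  have := hT 0 (Pi.single q 1) (fun r => by
    by_cases h : r = q
    · subst h; simpa using isHomogeneous_one _ _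
    · simpa [h] using isHomogeneous_zero _ _ _) p
  simpa using this

lemma mem_span_X_of_isHomogeneous {e : ℕ} (he : e ≠ 0) {p : MvPolynomial V 𝕜}
    (hp : p.IsHomogeneous e) : p ∈ Ideal.span (Set.range (X : V → MvPolynomial V 𝕜)) := by
  rw [← Set.image_univ, mem_ideal_span_X_image]
  intro m hm
  by_contra! h
  apply he
  rw [← hp (mem_support_iff.1 hm)]
  have : m = 0 := Finsupp.ext fun i => h i trivial
  simp [this]

lemma RaisesDegree.range_le {ι κ : Type} [Finite ι] [Finite κ] {e : ℕ} (he : e ≠ 0)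
    {T : (ι → MvPolynomial V 𝕜) →ₗ[MvPolynomial V 𝕜] (κ → MvPolynomial V 𝕜)}
    (hT : RaisesDegree e T) :
    LinearMap.range T ≤ Ideal.span (Set.range (X : V → MvPolynomial V 𝕜)) •
      (⊤ : Submodule (MvPolynomial V 𝕜) (κ → MvPolynomial V 𝕜)) := by
  classical
  have := Fintype.ofFinite ι
  have := Fintype.ofFinite κ
  rintro _ ⟨u, rfl⟩
  rw [LinearMap.pi_apply_eq_sum_univ T u]
  refine Submodule.sum_mem _ fun q _ => Submodule.smul_mem _ _ ?_
  rw [pi_eq_sum_univ (T _)]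
  refine Submodule.sum_mem _ fun p _ => Submodule.smul_mem_smul
    (mem_span_X_of_isHomogeneous he ?_) trivial
  convert hT.isHomogeneous_single q p using 3 with r
  simp [Pi.single_apply, eq_comm]

end Koszul

/-! ### Gluing two Koszul complexes along one generator -/

section Glued

variable {𝕜 : Type u} [Field 𝕜] {V : Type v}

/-- The basis elements in degree `i` of the resolution of the quotient by
`x · (y, l) + y · (x, m)`. -/
def GluedIndex (x y : V) (l m : List V) : ℕ → Type
  | 0 => Unit
  | 1 => Unit ⊕ (KoszulIndex l 1 ⊕ KoszulIndex m 1)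
  | i + 2 => KoszulIndex (y :: l) (i + 2) ⊕ KoszulIndex (x :: m) (i + 2)

noncomputable instance GluedIndex.fintype (x y : V) (l m : List V) :
    (i : ℕ) → Fintype (GluedIndex x y l m i)
  | 0 => inferInstanceAs (Fintype Unit)
  | 1 => inferInstanceAs (Fintype (Unit ⊕ (KoszulIndex l 1 ⊕ KoszulIndex m 1)))
  | i + 2 =>
    inferInstanceAs (Fintype (KoszulIndex (y :: l) (i + 2) ⊕ KoszulIndex (x :: m) (i + 2)))

lemma GluedIndex.card_eq (x y : V) (l m : List V) (i : ℕ) :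
    Nat.card (GluedIndex x y l m i) =
      if i = 0 then 1 else if i = 1 then l.length + m.length + 1
      else (l.length + 1).choose i + (m.length + 1).choose i := by
  match i with
  | 0 => simp [GluedIndex]
  | 1 => simp [-Nat.card_eq_fintype_card, GluedIndex, KoszulIndex.card_eq, Nat.card_sum]; ring
  | i + 2 => simp [-Nat.card_eq_fintype_card, GluedIndex, KoszulIndex.card_eq, Nat.card_sum]

/-- The direct sum of two linear maps between spaces of functions. -/
def sumMap {R : Type*} [CommRing R] {α β γ δ : Type*} (T : (α → R) →ₗ[R] (β → R))
    (S : (γ → R) →ₗ[R] (δ → R)) : (α ⊕ γ → R) →ₗ[R] (β ⊕ δ → R) where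
  toFun u := Sum.elim (T (u ∘ Sum.inl)) (S (u ∘ Sum.inr))
  map_add' a b := by
    funext p
    rcases p with p | p <;> simp [Pi.add_comp]
  map_smul' r a := by
    funext p
    rcases p with p | p <;> simp [Pi.smul_comp]

/-- The map which identifies the basis elements `e` of `R^(α ⊔ {e})` and `f` of `R^(β ⊔ {f})`. -/
def gluing {R : Type*} [CommRing R] {α β ε φ : Type*} [Unique ε] [Unique φ] :
    ((α ⊕ ε) ⊕ (β ⊕ φ) → R) →ₗ[R] (Unit ⊕ (α ⊕ β) → R) where
  toFun u := Sum.elim (fun _ => u (Sum.inl (Sum.inr default)) + u (Sum.inr (Sum.inr default)))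
    (Sum.elim (fun p => u (Sum.inl (Sum.inl p))) (fun p => u (Sum.inr (Sum.inl p))))
  map_add' a b := by
    funext p
    rcases p with p | p | p <;> simp; ring
  map_smul' r a := by
    funext p
    rcases p with p | p | p <;> simp; ring

/-- The map with values in `R` induced on the target of `gluing`. -/
def gluedAug {R : Type*} [CommRing R] {α β ε φ : Type*} [Unique ε] [Unique φ] (f g : R)
    (T : (α → R) →ₗ[R] (ε → R)) (S : (β → R) →ₗ[R] (φ → R)) :
    (Unit ⊕ (α ⊕ β) → R) →ₗ[R] (Unit → R) where
  toFun u := fun _ => f * g * u (Sum.inl ()) + f * T (u ∘ Sum.inr ∘ Sum.inl) default +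
    g * S (u ∘ Sum.inr ∘ Sum.inr) default
  map_add' a b := by
    funext p
    simp only [Pi.add_comp, map_add, Pi.add_apply]; ring
  map_smul' r a := by
    funext p
    simp only [Pi.smul_comp, map_smul, Pi.smul_apply, RingHom.id_apply, smul_eq_mul]; ring

/-- Both identified basis elements go to `f * g`, so the last differential can be computed on lifts
along `gluing`, where it is a combination of Koszul differentials. -/
lemma gluedAug_gluing {R : Type*} [CommRing R] {α β ε φ : Type*} [Unique ε] [Unique φ] (f g : R)
    (T : (α → R) →ₗ[R] (ε → R)) (S : (β → R) →ₗ[R] (φ → R)) (u : α ⊕ ε → R) (w : β ⊕ φ → R) :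
    gluedAug f g T S (gluing (Sum.elim u w)) =
      fun _ => f * coneZero g T u default + g * coneZero f S w default := by
  funext p
  change f * g * (u (Sum.inr default) + w (Sum.inr default)) +
    f * T (u ∘ Sum.inl) default + g * S (w ∘ Sum.inl) default =
    f * (T (u ∘ Sum.inl) default + g * u (Sum.inr default)) +
    g * (S (w ∘ Sum.inl) default + f * w (Sum.inr default))
  ring

/-- The differential of the resolution of the quotient by `x · (y, l) + y · (x, m)`. -/
noncomputable def gluedD (𝕜 : Type u) [Field 𝕜] {V : Type v} (x y : V) (l m : List V) : (i : ℕ) →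
    (GluedIndex x y l m (i + 1) → MvPolynomial V 𝕜) →ₗ[MvPolynomial V 𝕜]
      (GluedIndex x y l m i → MvPolynomial V 𝕜)
  | 0 => gluedAug (X x) (X y) (koszulD 𝕜 l 0) (koszulD 𝕜 m 0)
  | 1 => gluing ∘ₗ sumMap (koszulD 𝕜 (y :: l) 1) (koszulD 𝕜 (x :: m) 1)
  | i + 2 => sumMap (koszulD 𝕜 (y :: l) (i + 2)) (koszulD 𝕜 (x :: m) (i + 2))

/-- The ideal `x · (y, l) + y · (x, m)`. -/
noncomputable def gluedIdeal (𝕜 : Type u) [Field 𝕜] {V : Type v} (x y : V) (l m : List V) :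
    Ideal (MvPolynomial V 𝕜) :=
  Ideal.span {X x} * Ideal.span (X '' {v | v ∈ y :: l}) ⊔
    Ideal.span {X y} * Ideal.span (X '' {v | v ∈ x :: m})

variable {x y : V} {l m : List V}

lemma gluing_surjective {R : Type*} [CommRing R] {α β ε φ : Type*} [Unique ε] [Unique φ] :
    Function.Surjective (gluing : ((α ⊕ ε) ⊕ (β ⊕ φ) → R) →ₗ[R] (Unit ⊕ (α ⊕ β) → R)) := by
  intro w
  refine ⟨Sum.elim (Sum.elim (fun p => w (Sum.inr (Sum.inl p))) fun _ => w (Sum.inl ()))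
    (Sum.elim (fun p => w (Sum.inr (Sum.inr p))) fun _ => 0), ?_⟩
  funext p
  rcases p with p | p | p
  · exact add_zero _
  · rfl
  · rfl

lemma gluedD_zero_gluing (u : KoszulIndex (y :: l) 1 → MvPolynomial V 𝕜)
    (w : KoszulIndex (x :: m) 1 → MvPolynomial V 𝕜) :
    gluedD 𝕜 x y l m 0 (gluing (Sum.elim u w)) =
      fun _ => X x * koszulD 𝕜 (y :: l) 0 u default + X y * koszulD 𝕜 (x :: m) 0 w default :=
  gluedAug_gluing _ _ _ _ _ _

lemma gluedD_comp_gluedD : ∀ (i : ℕ) (u : GluedIndex x y l m (i + 2) → MvPolynomial V 𝕜),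
    gluedD 𝕜 x y l m i (gluedD 𝕜 x y l m (i + 1) u) = 0
  | 0, u => by
    obtain ⟨a, b, rfl⟩ := exists_sumElim u
    refine (gluedD_zero_gluing _ _).trans ?_
    funext p
    change X x * koszulD 𝕜 (y :: l) 0 (koszulD 𝕜 (y :: l) 1 a) default +
      X y * koszulD 𝕜 (x :: m) 0 (koszulD 𝕜 (x :: m) 1 b) default = 0
    rw [koszulD_comp_koszulD, koszulD_comp_koszulD]
    change X x * 0 + X y * 0 = 0
    simp
  | 1, u => by
    obtain ⟨a, b, rfl⟩ := exists_sumElim u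
    change gluing (Sum.elim (koszulD 𝕜 (y :: l) 1 (koszulD 𝕜 (y :: l) 2 a))
      (koszulD 𝕜 (x :: m) 1 (koszulD 𝕜 (x :: m) 2 b))) = 0
    rw [koszulD_comp_koszulD, koszulD_comp_koszulD]
    exact (congrArg _ Sum.elim_zero_zero).trans (map_zero _)
  | i + 2, u => by
    obtain ⟨a, b, rfl⟩ := exists_sumElim u
    change Sum.elim (koszulD 𝕜 (y :: l) (i + 2) (koszulD 𝕜 (y :: l) (i + 3) a))
      (koszulD 𝕜 (x :: m) (i + 2) (koszulD 𝕜 (x :: m) (i + 3) b)) = 0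
    rw [koszulD_comp_koszulD, koszulD_comp_koszulD, Sum.elim_zero_zero]

lemma range_gluedD_zero (w : Unit → MvPolynomial V 𝕜) :
    w ∈ LinearMap.range (gluedD 𝕜 x y l m 0) ↔ w () ∈ gluedIdeal 𝕜 x y l m := by
  rw [gluedIdeal, Submodule.mem_sup]
  constructor
  · rintro ⟨u, rfl⟩
    obtain ⟨u, rfl⟩ := gluing_surjective (ε := KoszulIndex l 0) (φ := KoszulIndex m 0) u
    obtain ⟨a, b, rfl⟩ := exists_sumElim u
    exact ⟨X x * koszulD 𝕜 (y :: l) 0 a default, Ideal.mul_mem_mul (Ideal.mem_span_singleton_self _)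
      ((mem_range_koszulD_zero _ _).1 ⟨a, rfl⟩), X y * koszulD 𝕜 (x :: m) 0 b default,
      Ideal.mul_mem_mul (Ideal.mem_span_singleton_self _)
      ((mem_range_koszulD_zero _ _).1 ⟨b, rfl⟩), (congrFun (gluedD_zero_gluing a b) ()).symm⟩
  · rintro ⟨p, hp, q, hq, h⟩
    obtain ⟨p, hp', rfl⟩ := Ideal.mem_span_singleton_mul.1 hp
    obtain ⟨q, hq', rfl⟩ := Ideal.mem_span_singleton_mul.1 hq
    obtain ⟨a, ha⟩ := (mem_range_koszulD_zero (y :: l) fun _ => p).2 hp'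
    obtain ⟨b, hb⟩ := (mem_range_koszulD_zero (x :: m) fun _ => q).2 hq'
    refine ⟨gluing (Sum.elim a b), ?_⟩
    rw [gluedD_zero_gluing, ha, hb]
    exact funext fun _ => h

lemma exists_koszulD_cons_zero_eq (v : V) (l : List V) (q : MvPolynomial V 𝕜) :
    ∃ e : KoszulIndex (v :: l) 1 → MvPolynomial V 𝕜, e = Sum.elim (fun _ => 0) (fun _ => q) ∧
      koszulD 𝕜 (v :: l) 0 e = fun _ => X v * q := by
  refine ⟨_, rfl, ?_⟩
  rw [koszulD_cons_zero]
  refine (congrArg (· + _) (map_zero (koszulD 𝕜 l 0))).trans ?_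
  exact zero_add _

/-- Only the two lowest degrees differ from a direct sum of Koszul complexes. In the lowest, the
coprimality of x and y allows a lift of the cycle to be replaced by a pair of Koszul cycles; in the
next, no nonzero Koszul boundary is lost under `gluing`. -/
lemma exists_of_gluedD_eq_zero (hxy : x ≠ y) (hl : (y :: l).Nodup) (hm : (x :: m).Nodup) :
    ∀ (i : ℕ) (u : GluedIndex x y l m (i + 1) → MvPolynomial V 𝕜), gluedD 𝕜 x y l m i u = 0 →
      ∃ w, gluedD 𝕜 x y l m (i + 1) w = u
  | 0, u, hu => by
    obtain ⟨u, rfl⟩ := gluing_surjective (ε := KoszulIndex l 0) (φ := KoszulIndex m 0) u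
    obtain ⟨a, b, rfl⟩ : ∃ (a : KoszulIndex (y :: l) 1 → MvPolynomial V 𝕜)
      (b : KoszulIndex (x :: m) 1 → MvPolynomial V 𝕜), u = Sum.elim a b := exists_sumElim u
    have h : X x * koszulD 𝕜 (y :: l) 0 a default + X y * koszulD 𝕜 (x :: m) 0 b default = 0 :=
      congrFun ((gluedD_zero_gluing a b).symm.trans hu) ()
    -- The prime X_y divides X_x times this element and does not divide X_x.
    have hdvd : (X y : MvPolynomial V 𝕜) ∣ koszulD 𝕜 (y :: l) 0 a default := by
      refine ((X_prime (R := 𝕜) (i := y)).dvd_or_dvd (a := X x)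
        ⟨-koszulD 𝕜 (x :: m) 0 b default, ?_⟩).resolve_left ?_
      · rw [mul_neg]; exact eq_neg_of_add_eq_zero_left h
      · intro h
        rw [X_dvd_X] at h
        exact hxy h.symm
    obtain ⟨q, hq⟩ := hdvd
    have hq' : koszulD 𝕜 (x :: m) 0 b default = -(X x * q) := by
      apply mul_left_cancel₀ (X_ne_zero (R := 𝕜) y)
      rw [hq] at h
      linear_combination h
    -- `e` and `f` are `q` times the two identified basis elements. Passing from `(a, b)` to `(a -
    -- e, b + f)` leaves the image under `gluing` unchanged and makes both components Koszul cycles.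
    obtain ⟨e, he, he'⟩ := exists_koszulD_cons_zero_eq y l q
    obtain ⟨f, hf, hf'⟩ := exists_koszulD_cons_zero_eq x m q
    have ha : koszulD 𝕜 (y :: l) 0 (a - e) = 0 := by
      rw [map_sub, he', sub_eq_zero]
      funext p
      rw [Unique.eq_default p]
      exact hq
    have hb : koszulD 𝕜 (x :: m) 0 (b + f) = 0 := by
      rw [map_add, hf']
      funext p
      rw [Unique.eq_default p]
      exact add_eq_zero_iff_eq_neg.2 hq'
    obtain ⟨c, hc⟩ := exists_of_koszulD_eq_zero _ hl _ _ ha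
    obtain ⟨d, hd⟩ := exists_of_koszulD_eq_zero _ hm _ _ hb
    refine ⟨Sum.elim c d, ?_⟩
    change gluing (Sum.elim (koszulD 𝕜 (y :: l) 1 c) (koszulD 𝕜 (x :: m) 1 d)) = _
    rw [hc, hd, he, hf]
    funext p
    rcases p with p | p | p
    · change a _ - q + (b _ + q) = a _ + b _
      ring
    · exact sub_zero (a (Sum.inl p))
    · exact add_zero (b (Sum.inl p))
  | 1, u, hu => by
    obtain ⟨a, b, rfl⟩ := exists_sumElim u
    set a' := koszulD 𝕜 (y :: l) 1 a with ha'
    set b' := koszulD 𝕜 (x :: m) 1 b with hb'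
    have hu : gluing (Sum.elim a' b') = 0 := hu
    have ha : koszulD 𝕜 (y :: l) 0 a' = 0 := koszulD_comp_koszulD _ _ _
    have hb : koszulD 𝕜 (x :: m) 0 b' = 0 := koszulD_comp_koszulD _ _ _
    -- The kernel of `gluing` is supported on the two identified basis elements, and a Koszul cycle
    -- supported there is zero because X_y and X_x are nonzero in a domain.
    obtain ⟨a₁, a₂, h₁⟩ : ∃ a₁ a₂, a' = Sum.elim a₁ a₂ := exists_sumElim a'
    obtain ⟨b₁, b₂, h₂⟩ : ∃ b₁ b₂, b' = Sum.elim b₁ b₂ := exists_sumElim b'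
    rw [h₁, h₂] at hu
    have e₁ : a₁ = 0 := funext fun p => congrFun hu (Sum.inr (Sum.inl p))
    have e₂ : b₁ = 0 := funext fun p => congrFun hu (Sum.inr (Sum.inr p))
    rw [h₁, e₁, koszulD_cons_zero, map_zero, zero_add] at ha
    rw [h₂, e₂, koszulD_cons_zero, map_zero, zero_add] at hb
    have f₁ : a₂ = 0 := (smul_eq_zero.1 ha).resolve_left (X_ne_zero y)
    have f₂ : b₂ = 0 := (smul_eq_zero.1 hb).resolve_left (X_ne_zero x)
    rw [e₁, f₁, Sum.elim_zero_zero] at h₁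
    rw [e₂, f₂, Sum.elim_zero_zero] at h₂
    obtain ⟨c, hc⟩ := exists_of_koszulD_eq_zero _ hl _ _ (ha'.symm.trans h₁)
    obtain ⟨d, hd⟩ := exists_of_koszulD_eq_zero _ hm _ _ (hb'.symm.trans h₂)
    refine ⟨Sum.elim c d, ?_⟩
    rw [← hc, ← hd]
    rfl
  | i + 2, u, hu => by
    obtain ⟨a, b, rfl⟩ := exists_sumElim u
    have ha : koszulD 𝕜 (y :: l) (i + 2) a = 0 := funext fun p => congrFun hu (Sum.inl p)
    have hb : koszulD 𝕜 (x :: m) (i + 2) b = 0 := funext fun p => congrFun hu (Sum.inr p)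
    obtain ⟨c, rfl⟩ := exists_of_koszulD_eq_zero _ hl _ _ ha
    obtain ⟨d, rfl⟩ := exists_of_koszulD_eq_zero _ hm _ _ hb
    exact ⟨Sum.elim c d, rfl⟩

lemma gluing_raisesDegree {α β ε φ : Type} [Unique ε] [Unique φ] :
    RaisesDegree 0 (gluing (R := MvPolynomial V 𝕜) (α := α) (β := β) (ε := ε) (φ := φ)) := by
  intro d u hu p
  rcases p with p | p | p
  · exact (hu _).add (hu _)
  · exact hu _
  · exact hu _

lemma sumMap_raisesDegree {α β γ δ : Type} {e : ℕ}
    {T : (α → MvPolynomial V 𝕜) →ₗ[MvPolynomial V 𝕜] (β → MvPolynomial V 𝕜)}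
    {S : (γ → MvPolynomial V 𝕜) →ₗ[MvPolynomial V 𝕜] (δ → MvPolynomial V 𝕜)}
    (hT : RaisesDegree e T) (hS : RaisesDegree e S) : RaisesDegree e (sumMap T S) := by
  intro d u hu p
  rcases p with p | p
  · exact hT d _ (fun q => hu _) p
  · exact hS d _ (fun q => hu _) p

/-- The ideal is generated by quadrics, and all later matrices are linear, since `gluing` has
constant coefficients. -/
lemma gluedD_raisesDegree : ∀ (i : ℕ),
    RaisesDegree (if i = 0 then 2 else 1) (gluedD 𝕜 x y l m i)
  | 0 => by
    intro d u hu p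
    have h1 : ((X x * X y) * u (Sum.inl ()) : MvPolynomial V 𝕜).IsHomogeneous (1 + 1 + d) :=
      ((isHomogeneous_X 𝕜 x).mul (isHomogeneous_X 𝕜 y)).mul (hu _)
    have h2 : (X x * koszulD 𝕜 l 0 (u ∘ Sum.inr ∘ Sum.inl) default).IsHomogeneous (1 + (d + 1)) :=
      (isHomogeneous_X 𝕜 x).mul (koszulD_raisesDegree l 0 d _ (fun q => hu _) _)
    have h3 : (X y * koszulD 𝕜 m 0 (u ∘ Sum.inr ∘ Sum.inr) default).IsHomogeneous (1 + (d + 1)) :=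
      (isHomogeneous_X 𝕜 y).mul (koszulD_raisesDegree m 0 d _ (fun q => hu _) _)
    rw [show 1 + 1 + d = d + 2 by ring] at h1
    rw [show 1 + (d + 1) = d + 2 by ring] at h2 h3
    exact (h1.add h2).add h3
  | 1 => fun d u hu => gluing_raisesDegree (d + 1) _
      (sumMap_raisesDegree (koszulD_raisesDegree _ _) (koszulD_raisesDegree _ _) d u hu)
  | i + 2 => sumMap_raisesDegree (koszulD_raisesDegree _ _) (koszulD_raisesDegree _ _)

end Glued

/-! ### The glued complex as a minimal graded projective resolution -/

section Category

variable (𝕜 : Type u) [Field 𝕜] {V : Type v} (x y : V) (l m : List V)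

/-- The glued Koszul complexes, as a chain complex. -/
noncomputable def gluedComplex : ChainComplex (ModuleCat.{max v u} (MvPolynomial V 𝕜)) ℕ :=
  ChainComplex.of (fun i => ModuleCat.of (MvPolynomial V 𝕜) (GluedIndex x y l m i → MvPolynomial V 𝕜))
    (fun i => ModuleCat.ofHom (gluedD 𝕜 x y l m i))
    (fun i => by
      ext1
      exact LinearMap.ext fun u => gluedD_comp_gluedD i u)

lemma gluedComplex_d (i : ℕ) :
    (gluedComplex 𝕜 x y l m).d (i + 1) i = ModuleCat.ofHom (gluedD 𝕜 x y l m i) :=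
  ChainComplex.of_d (fun i => ModuleCat.of (MvPolynomial V 𝕜)
    (GluedIndex x y l m i → MvPolynomial V 𝕜)) (fun i => ModuleCat.ofHom (gluedD 𝕜 x y l m i)) i

/-- The augmentation of the glued Koszul complexes. -/
noncomputable def gluedAugmentation :
    (gluedComplex 𝕜 x y l m).X 0 ⟶ quotientModule (gluedIdeal 𝕜 x y l m) :=
  ModuleCat.ofHom ((Submodule.mkQ (gluedIdeal 𝕜 x y l m)) ∘ₗ
    (LinearMap.proj () : (Unit → MvPolynomial V 𝕜) →ₗ[MvPolynomial V 𝕜] MvPolynomial V 𝕜))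

lemma gluedComplex_d_comp_augmentation :
    (gluedComplex 𝕜 x y l m).d 1 0 ≫ gluedAugmentation 𝕜 x y l m = 0 := by
  rw [gluedComplex_d]
  ext1
  refine LinearMap.ext fun u => ?_
  exact Ideal.Quotient.eq_zero_iff_mem.2 ((range_gluedD_zero _).1 ⟨u, rfl⟩)

variable {x y l m}

lemma gluedComplex_exactAt_succ (hxy : x ≠ y) (hl : (y :: l).Nodup) (hm : (x :: m).Nodup) (i : ℕ) :
    (gluedComplex 𝕜 x y l m).ExactAt (i + 1) := by
  rw [HomologicalComplex.exactAt_iff' _ (i + 1 + 1) (i + 1) i (by simp) (by simp),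
    ShortComplex.moduleCat_exact_iff]
  intro u hu
  change ((gluedComplex 𝕜 x y l m).d (i + 1) i).hom u = 0 at hu
  change ∃ w, ((gluedComplex 𝕜 x y l m).d (i + 2) (i + 1)).hom w = u
  rw [gluedComplex_d] at hu ⊢
  exact exists_of_gluedD_eq_zero hxy hl hm i u hu

lemma gluedComplex_exact_zero :
    (ShortComplex.mk _ _ (gluedComplex_d_comp_augmentation 𝕜 x y l m)).Exact := by
  rw [ShortComplex.moduleCat_exact_iff]
  intro w hw
  change ∃ u, ((gluedComplex 𝕜 x y l m).d 1 0).hom u = w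
  rw [gluedComplex_d]
  exact (range_gluedD_zero (𝕜 := 𝕜) (x := x) (y := y) (l := l) (m := m) w).2
    (Ideal.Quotient.eq_zero_iff_mem.1 hw)

instance : Epi (gluedAugmentation 𝕜 x y l m) := by
  rw [ModuleCat.epi_iff_surjective]
  intro q
  obtain ⟨p, rfl⟩ := Ideal.Quotient.mk_surjective q
  exact ⟨fun _ => p, rfl⟩

/-- The glued Koszul complexes resolve the quotient by `x · (y, l) + y · (x, m)`. -/
noncomputable def gluedResolution (hxy : x ≠ y) (hl : (y :: l).Nodup) (hm : (x :: m).Nodup) :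
    ProjectiveResolution (quotientModule (gluedIdeal 𝕜 x y l m)) where
  complex := gluedComplex 𝕜 x y l m
  projective i := ModuleCat.projective_of_free (M := (gluedComplex 𝕜 x y l m).X i)
    (Pi.basisFun (MvPolynomial V 𝕜) (GluedIndex x y l m i))
  π := (ChainComplex.toSingle₀Equiv _ _).symm
    ⟨gluedAugmentation 𝕜 x y l m, gluedComplex_d_comp_augmentation 𝕜 x y l m⟩
  quasiIso := ⟨fun n => by
    cases n
    · rw [ChainComplex.quasiIsoAt₀_iff, ShortComplex.quasiIso_iff_of_zeros']
      · refine (ShortComplex.exact_and_epi_g_iff_of_iso ?_).2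
          ⟨gluedComplex_exact_zero 𝕜 (x := x) (y := y) (l := l) (m := m), inferInstance⟩
        exact ShortComplex.isoMk (Iso.refl _) (Iso.refl _) (Iso.refl _)
          (by simp; exact (Category.id_comp _).trans (Category.comp_id _).symm)
          (by simp; exact (Category.id_comp _).trans (Category.comp_id _).symm)
      all_goals rfl
    · rw [quasiIsoAt_iff_exactAt']
      · exact gluedComplex_exactAt_succ 𝕜 hxy hl hm _
      · apply ChainComplex.exactAt_succ_single_obj⟩

lemma gluedResolution_isMinimalFree (hxy : x ≠ y) (hl : (y :: l).Nodup) (hm : (x :: m).Nodup) :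
    IsMinimalFree (gluedResolution 𝕜 hxy hl hm) where
  free i := inferInstanceAs
    (Module.Free (MvPolynomial V 𝕜) (GluedIndex x y l m i → MvPolynomial V 𝕜))
  finite i := inferInstanceAs
    (Module.Finite (MvPolynomial V 𝕜) (GluedIndex x y l m i → MvPolynomial V 𝕜))
  minimal i := by
    change LinearMap.range ((gluedComplex 𝕜 x y l m).d (i + 1) i).hom ≤ _
    rw [gluedComplex_d]
    exact (gluedD_raisesDegree i).range_le (by split_ifs <;> simp)

lemma finrank_gluedResolution (hxy : x ≠ y) (hl : (y :: l).Nodup) (hm : (x :: m).Nodup) (i : ℕ) :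
    Module.finrank (MvPolynomial V 𝕜) ((gluedResolution 𝕜 hxy hl hm).complex.X i) =
      if i = 0 then 1 else if i = 1 then l.length + m.length + 1
      else (l.length + 1).choose i + (m.length + 1).choose i := by
  rw [← GluedIndex.card_eq x y l m i, Nat.card_eq_fintype_card]
  exact Module.finrank_fintype_fun_eq_card _

lemma augmentation_gluedResolution (hxy : x ≠ y) (hl : (y :: l).Nodup) (hm : (x :: m).Nodup)
    (w : Unit → MvPolynomial V 𝕜) :
    augmentation (gluedResolution 𝕜 hxy hl hm) w =
      Ideal.Quotient.mk (gluedIdeal 𝕜 x y l m) (w ()) := by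
  have : (gluedResolution 𝕜 hxy hl hm).π.f 0 ≫
      (HomologicalComplex.singleObjXSelf (ComplexShape.down ℕ) 0 _).hom =
      gluedAugmentation 𝕜 x y l m := by
    refine (congrArg (· ≫ _) (ChainComplex.toSingle₀Equiv_symm_apply_f_zero
      (gluedAugmentation 𝕜 x y l m) (gluedComplex_d_comp_augmentation 𝕜 x y l m))).trans ?_
    exact Category.comp_id _
  rw [augmentation, this]
  rfl

lemma gluedResolution_isGradedFree (hxy : x ≠ y) (hl : (y :: l).Nodup) (hm : (x :: m).Nodup) :
    IsGradedFree (gluedResolution 𝕜 hxy hl hm) := by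
  classical
  let E : ∀ i, GluedIndex x y l m i ≃ Fin (Fintype.card (GluedIndex x y l m i)) :=
    fun i => Fintype.equivFin _
  let B : ∀ i, Module.Basis (Fin (Fintype.card (GluedIndex x y l m i))) (MvPolynomial V 𝕜)
      (GluedIndex x y l m i → MvPolynomial V 𝕜) :=
    fun i => (Pi.basisFun (MvPolynomial V 𝕜) (GluedIndex x y l m i)).reindex (E i)
  have hB : ∀ i q, B i q = Pi.single ((E i).symm q) 1 := fun i q => by
    simp [B, Module.Basis.reindex_apply, Pi.basisFun_apply]
  -- The resolution is linear after the quadratic first step, so the generators in homological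
  -- degree i ≥ 1 have degree i + 1.
  refine ⟨fun i => Fintype.card (GluedIndex x y l m i), B, fun i _ => if i = 0 then 0 else i + 1,
    ?_, ?_⟩
  · intro i p q _
    refine ⟨if i = 0 then 2 else 1, ?_, ?_⟩
    · change ((B i).repr (((gluedComplex 𝕜 x y l m).d (i + 1) i).hom (B (i + 1) q)) p).IsHomogeneous
        _
      rw [gluedComplex_d]
      change ((B i).repr (gluedD 𝕜 x y l m i (B (i + 1) q)) p).IsHomogeneous _
      rw [hB]
      have := (gluedD_raisesDegree (𝕜 := 𝕜) (x := x) (y := y) (l := l) (m := m)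
        i).isHomogeneous_single ((E (i + 1)).symm q) ((E i).symm p)
      simpa [B] using this
    · rcases i with _ | i <;> simp
  · intro q _
    refine ⟨0, 1, isHomogeneous_one _ _, by simp, ?_⟩
    refine (augmentation_gluedResolution 𝕜 hxy hl hm (B 0 q)).trans (congrArg _ ?_)
    rw [hB]
    have : (E 0).symm q = () := rfl
    rw [this]
    exact Pi.single_eq_same _ _

end Category

/-! ### Invariants read off a minimal free resolution -/

section Minimal

open TensorProduct in
lemma baseChange_quotient_eq_of_sub_mem {R M N : Type*} [CommRing R] [AddCommGroup M] [Module R M]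
    [AddCommGroup N] [Module R N] {I : Ideal R} {f g : M →ₗ[R] N}
    (h : ∀ u, f u - g u ∈ I • (⊤ : Submodule R N)) :
    f.baseChange (R ⧸ I) = g.baseChange (R ⧸ I) := by
  rw [← sub_eq_zero, ← LinearMap.baseChange_sub]
  refine LinearMap.ext fun z => ?_
  induction z using TensorProduct.induction_on with
  | zero => rw [map_zero, map_zero]
  | add a b ha hb => rw [map_add, ha, hb, map_add]
  | tmul q u =>
    rw [LinearMap.baseChange_tmul, LinearMap.zero_apply]
    refine Submodule.smul_induction_on (p := fun w => q ⊗ₜ[R] w = 0) (h u)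
      (fun r hr n _ => ?_) (fun a b ha hb => ?_)
    · rw [← TensorProduct.smul_tmul, Algebra.smul_def]
      have : algebraMap R (R ⧸ I) r = 0 := Ideal.Quotient.eq_zero_iff_mem.2 hr
      rw [this, zero_mul, TensorProduct.zero_tmul]
    · rw [TensorProduct.tmul_add, ha, hb, add_zero]

/-- Modulo `I` the two maps become mutually inverse, and base change to the nontrivial ring `R ⧸ I`
preserves the rank of a free module. -/
lemma finrank_eq_of_comp_sub_id_mem {R M N : Type*} [CommRing R] [AddCommGroup M] [Module R M]
    [AddCommGroup N] [Module R N] [Module.Free R M] [Module.Free R N] {I : Ideal R} (hI : I ≠ ⊤)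
    (f : M →ₗ[R] N) (g : N →ₗ[R] M) (hgf : ∀ u, g (f u) - u ∈ I • (⊤ : Submodule R M))
    (hfg : ∀ u, f (g u) - u ∈ I • (⊤ : Submodule R N)) :
    Module.finrank R M = Module.finrank R N := by
  have : Nontrivial (R ⧸ I) := Ideal.Quotient.nontrivial_iff.2 hI
  have : Nontrivial R := (Ideal.Quotient.mk I).domain_nontrivial
  have h1 : (g.baseChange (R ⧸ I)) ∘ₗ (f.baseChange (R ⧸ I)) = LinearMap.id := by
    rw [← LinearMap.baseChange_comp, ← LinearMap.baseChange_id]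
    exact baseChange_quotient_eq_of_sub_mem hgf
  have h2 : (f.baseChange (R ⧸ I)) ∘ₗ (g.baseChange (R ⧸ I)) = LinearMap.id := by
    rw [← LinearMap.baseChange_comp, ← LinearMap.baseChange_id]
    exact baseChange_quotient_eq_of_sub_mem hfg
  rw [← Module.finrank_baseChange (R := R ⧸ I) (S := R) (M' := M),
    ← Module.finrank_baseChange (R := R ⧸ I) (S := R) (M' := N)]
  exact (LinearEquiv.ofLinearMap _ _ h2 h1).finrank_eq

lemma map_mem_smul_top {R M N : Type*} [CommRing R] [AddCommGroup M] [Module R M]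
    [AddCommGroup N] [Module R N] {I : Ideal R} (f : M →ₗ[R] N) {u : M}
    (hu : u ∈ I • (⊤ : Submodule R M)) : f u ∈ I • (⊤ : Submodule R N) := by
  have := Submodule.mem_map_of_mem (f := f) hu
  rw [Submodule.map_smul''] at this
  exact Submodule.smul_mono le_rfl le_top this

/-- The difference is dh + hd, and by minimality of `D` and `C` respectively each term lands in `I`
times the target. -/
lemma homotopy_sub_mem_smul_top {R : Type u} [CommRing R] {I : Ideal R}
    {C D : ChainComplex (ModuleCat.{v} R) ℕ}
    (hC : ∀ i, LinearMap.range (C.d (i + 1) i).hom ≤ I • (⊤ : Submodule R (C.X i)))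
    (hD : ∀ i, LinearMap.range (D.d (i + 1) i).hom ≤ I • (⊤ : Submodule R (D.X i)))
    {f g : C ⟶ D} (h : Homotopy f g) (i : ℕ) (u : C.X i) :
    (f.f i).hom u - (g.f i).hom u ∈ I • (⊤ : Submodule R (D.X i)) := by
  rw [h.comm i, Homotopy.prevD_chainComplex]
  rcases i with _ | i
  · rw [Homotopy.dNext_zero_chainComplex, zero_add, ModuleCat.hom_add, LinearMap.add_apply,
      add_sub_cancel_right]
    exact hD _ ⟨_, rfl⟩
  · rw [Homotopy.dNext_succ_chainComplex, ModuleCat.hom_add, LinearMap.add_apply,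
      add_sub_cancel_right, ModuleCat.hom_add, LinearMap.add_apply]
    exact add_mem (map_mem_smul_top (h.hom i (i + 1)).hom (hC _ ⟨u, rfl⟩)) (hD _ ⟨_, rfl⟩)

lemma span_range_X_ne_top (𝕜 : Type u) [Field 𝕜] (V : Type v) :
    Ideal.span (Set.range (MvPolynomial.X : V → MvPolynomial V 𝕜)) ≠ ⊤ := by
  rw [Ideal.ne_top_iff_one, ← Set.image_univ, MvPolynomial.mem_ideal_span_X_image]
  intro h
  obtain ⟨i, -, hi⟩ := h 0 (by simp)
  exact hi rfl

variable {𝕜 : Type u} [Field 𝕜] {V : Type v} {M : ModuleCat.{max v u} (MvPolynomial V 𝕜)}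

/-- Two resolutions are homotopy equivalent, and between minimal complexes a homotopy equivalence is
an isomorphism modulo the ideal of the variables. -/
lemma IsMinimalFree.finrank_eq {F G : ProjectiveResolution M} (hF : IsMinimalFree F)
    (hG : IsMinimalFree G) (i : ℕ) :
    Module.finrank (MvPolynomial V 𝕜) (F.complex.X i) =
      Module.finrank (MvPolynomial V 𝕜) (G.complex.X i) := by
  let e := ProjectiveResolution.homotopyEquiv F G
  have := hF.free i
  have := hG.free i
  exact finrank_eq_of_comp_sub_id_mem (span_range_X_ne_top 𝕜 V) (e.hom.f i).hom (e.inv.f i).hom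
    (homotopy_sub_mem_smul_top hF.minimal hF.minimal e.homotopyHomInvId i)
    (homotopy_sub_mem_smul_top hG.minimal hG.minimal e.homotopyInvHomId i)

/-- Freeness replaces Nakayama's lemma: a coordinate function would send its basis vector, on which
it is 1, into `I`. -/
lemma smul_top_ne_top {R N : Type*} [CommRing R] [AddCommGroup N] [Module R N] [Module.Free R N]
    [Nontrivial N] {I : Ideal R} (hI : I ≠ ⊤) : I • (⊤ : Submodule R N) ≠ ⊤ := by
  intro h
  let b := Module.Free.chooseBasis R N
  have : Nontrivial R := Module.nontrivial R N
  obtain ⟨k⟩ := b.index_nonempty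
  apply hI
  rw [Ideal.eq_top_iff_one]
  have := map_mem_smul_top (b.coord k) (h ▸ (Submodule.mem_top : b k ∈ ⊤))
  simpa using this

/-- A nonzero F_i with i ≥ 1 is detected by Ext^i(M, F_i/𝔪F_i): minimality makes the projection F_i
→ F_i/𝔪F_i a cocycle. If it were a coboundary, it would factor through ∂(F_i) ⊆ 𝔪F_{i-1} and hence
vanish, forcing F_i = 𝔪F_i. -/
lemma IsMinimalFree.hasProjectiveDimensionLT_iff {F : ProjectiveResolution M}
    (hF : IsMinimalFree F) (n : ℕ) :
    HasProjectiveDimensionLT M (n + 1) ↔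
      ∀ i, n + 1 ≤ i → Module.finrank (MvPolynomial V 𝕜) (F.complex.X i) = 0 := by
  rw [CategoryTheory.hasProjectiveDimensionLT_iff]
  refine forall₂_congr fun i hi => ?_
  obtain ⟨i, rfl⟩ : ∃ j, i = j + 1 := ⟨i - 1, by omega⟩
  have := hF.free (i + 1)
  have := hF.finite (i + 1)
  constructor
  · intro h
    by_contra hne
    have : Nontrivial (F.complex.X (i + 1)) :=
      Module.nontrivial_of_finrank_pos (R := MvPolynomial V 𝕜) (Nat.pos_of_ne_zero hne)
    set I := Ideal.span (Set.range (MvPolynomial.X : V → MvPolynomial V 𝕜)) with hI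
    let W := I • (⊤ : Submodule (MvPolynomial V 𝕜) (F.complex.X (i + 1)))
    let f : F.complex.X (i + 1) ⟶ ModuleCat.of (MvPolynomial V 𝕜) (F.complex.X (i + 1) ⧸ W) :=
      ModuleCat.ofHom W.mkQ
    have hf : F.complex.d (i + 2) (i + 1) ≫ f = 0 := by
      ext u
      exact (Submodule.Quotient.mk_eq_zero W).2 (hF.minimal (i + 1) ⟨u, rfl⟩)
    obtain ⟨g, hg⟩ := (F.extMk_eq_zero_iff f (i + 2) rfl hf i rfl).1 (h _)
    apply smul_top_ne_top (N := F.complex.X (i + 1)) (span_range_X_ne_top 𝕜 V)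
    rw [eq_top_iff]
    rintro u -
    apply (Submodule.Quotient.mk_eq_zero W).1
    have h1 : f.hom u = g.hom ((F.complex.d (i + 1) i).hom u) := by rw [← hg]; rfl
    have h2 := map_mem_smul_top g.hom (hF.minimal i ⟨u, rfl⟩)
    rw [← h1] at h2
    have h3 : I • (⊤ : Submodule (MvPolynomial V 𝕜) (F.complex.X (i + 1) ⧸ W)) = ⊥ := by
      rw [← Submodule.range_mkQ W, ← Submodule.map_top, ← Submodule.map_smul'',
        Submodule.mkQ_map_self]
    exact (Submodule.mem_bot _).1 (h3 ▸ h2)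
  · intro h Y e
    have : Subsingleton (F.complex.X (i + 1)) := Module.finrank_zero_iff.1 h
    obtain ⟨f, hf, rfl⟩ := F.extMk_surjective e (i + 2) rfl
    have : f = 0 := by
      ext u
      rw [Subsingleton.elim u 0, map_zero, map_zero]
    subst this
    exact F.extMk_zero _ _

end Minimal

/-! ### The Lyubeznik graph -/

section Lyubeznik

open LVertex in
-- The edges are sorted by whether they contain x or y. The z_k are adjacent to both and so occur in
-- both lists; the edge xy is produced twice.
lemma edgeIdeal_lyubeznikGraph (𝕜 : Type u) [Field 𝕜] (a b c : ℕ) :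
    edgeIdeal 𝕜 (lyubeznikGraph a b c) =
      gluedIdeal 𝕜 (x : LVertex a b c) y (List.ofFn xs ++ List.ofFn zs)
        (List.ofFn ys ++ List.ofFn zs) := by
  rw [edgeIdeal, gluedIdeal, Ideal.span_mul_span', Ideal.span_mul_span', ← Ideal.span_union]
  apply le_antisymm
  · rw [Ideal.span_le]
    rintro _ ⟨u, w, h, rfl⟩
    apply Ideal.subset_span
    simp only [lyubeznikGraph, SimpleGraph.fromEdgeSet_adj, Set.mem_union, Set.mem_singleton_iff,
      Set.mem_range, Sym2.eq_iff] at h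
    simp only [Set.mem_union, Set.mem_mul, Set.mem_singleton_iff, Set.mem_image, exists_eq_left,
      exists_exists_and_eq_and, Set.mem_ofPred_eq, List.mem_cons, List.mem_append, List.mem_ofFn]
    rcases h.1 with (((⟨rfl, rfl⟩ | ⟨rfl, rfl⟩) | ⟨i, ⟨rfl, rfl⟩ | ⟨rfl, rfl⟩⟩) |
      ⟨i, ⟨rfl, rfl⟩ | ⟨rfl, rfl⟩⟩) | (⟨i, ⟨rfl, rfl⟩ | ⟨rfl, rfl⟩⟩ | ⟨i, ⟨rfl, rfl⟩ | ⟨rfl, rfl⟩⟩)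
    · exact Or.inl ⟨y, by simp, rfl⟩
    · exact Or.inl ⟨y, by simp, mul_comm _ _⟩
    · exact Or.inl ⟨xs i, by simp, rfl⟩
    · exact Or.inl ⟨xs i, by simp, mul_comm _ _⟩
    · exact Or.inr ⟨ys i, by simp, rfl⟩
    · exact Or.inr ⟨ys i, by simp, mul_comm _ _⟩
    · exact Or.inl ⟨zs i, by simp, rfl⟩
    · exact Or.inl ⟨zs i, by simp, mul_comm _ _⟩
    · exact Or.inr ⟨zs i, by simp, rfl⟩
    · exact Or.inr ⟨zs i, by simp, mul_comm _ _⟩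
  · rw [Ideal.span_le]
    rintro _ (⟨_, rfl, _, ⟨w, hw, rfl⟩, rfl⟩ | ⟨_, rfl, _, ⟨w, hw, rfl⟩, rfl⟩)
    · simp only [Set.mem_ofPred_eq, List.mem_cons, List.mem_append, List.mem_ofFn] at hw
      rcases hw with rfl | ⟨i, rfl⟩ | ⟨i, rfl⟩
      · exact Ideal.subset_span ⟨x, y, by simp [lyubeznikGraph], rfl⟩
      · exact Ideal.subset_span ⟨x, xs i, by simp [lyubeznikGraph], rfl⟩
      · exact Ideal.subset_span ⟨x, zs i, by simp [lyubeznikGraph], rfl⟩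
    · simp only [Set.mem_ofPred_eq, List.mem_cons, List.mem_append, List.mem_ofFn] at hw
      rcases hw with rfl | ⟨i, rfl⟩ | ⟨i, rfl⟩
      · exact Ideal.subset_span ⟨y, x, by simp [lyubeznikGraph], rfl⟩
      · exact Ideal.subset_span ⟨y, ys i, by simp [lyubeznikGraph], rfl⟩
      · exact Ideal.subset_span ⟨y, zs i, by simp [lyubeznikGraph], rfl⟩

lemma projectiveDimension_gluedIdeal {𝕜 : Type u} [Field 𝕜] {V : Type v} {x y : V} {l m : List V}
    (hxy : x ≠ y) (hl : (y :: l).Nodup) (hm : (x :: m).Nodup) :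
    projectiveDimension (quotientModule (gluedIdeal 𝕜 x y l m)) =
      ((max (l.length + 1) (m.length + 1) : ℕ) : WithBot ℕ∞) := by
  have hG := gluedResolution_isMinimalFree 𝕜 hxy hl hm
  apply le_antisymm
  · rw [projectiveDimension_le_iff, HasProjectiveDimensionLE, hG.hasProjectiveDimensionLT_iff]
    intro i hi
    rw [finrank_gluedResolution, if_neg (by omega), if_neg (by omega),
      Nat.choose_eq_zero_of_lt (by omega), Nat.choose_eq_zero_of_lt (by omega)]
  · obtain ⟨n, hn⟩ : ∃ n, max (l.length + 1) (m.length + 1) = n + 1 :=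
      ⟨max l.length m.length, by omega⟩
    rw [projectiveDimension_ge_iff, hn, hG.hasProjectiveDimensionLT_iff]
    intro h
    -- At this index the rank cannot vanish: n + 1 is the larger of the two list lengths plus one,
    -- so one of the binomial coefficients is 1 when n ≥ 1.
    have := h (n + 1) le_rfl
    rw [finrank_gluedResolution, if_neg (by omega)] at this
    split_ifs at this
    rw [Nat.add_eq_zero_iff, Nat.choose_eq_zero_iff, Nat.choose_eq_zero_iff] at this
    omega

end Lyubeznik

theorem corollary3p3 (𝕜 : Type u) [Field 𝕜] (a b c : ℕ) :
    (∃ F : ProjectiveResolution (quotientModule (edgeIdeal 𝕜 (lyubeznikGraph a b c))),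
      IsMinimalFree F ∧ IsGradedFree F) ∧
    (∀ F : ProjectiveResolution (quotientModule (edgeIdeal 𝕜 (lyubeznikGraph a b c))),
      IsMinimalFree F → ∀ i : ℕ,
        Module.finrank (MvPolynomial (LVertex a b c) 𝕜) (F.complex.X i) =
          if i = 0 then 1
          else if i = 1 then a + b + 2 * c + 1
          else (a + c + 1).choose i + (b + c + 1).choose i) ∧
    projectiveDimension (quotientModule (edgeIdeal 𝕜 (lyubeznikGraph a b c))) =
      ((max (a + c + 1) (b + c + 1) : ℕ) : WithBot ℕ∞) := by
  have hxy : (LVertex.x : LVertex a b c) ≠ LVertex.y := by simp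
  have hl : ((LVertex.y : LVertex a b c) :: (List.ofFn LVertex.xs ++ List.ofFn LVertex.zs)).Nodup := by
    simp only [List.nodup_cons, List.mem_append, List.mem_ofFn, reduceCtorEq, exists_false,
      or_self, not_false_eq_true, true_and]
    refine List.Nodup.append (List.nodup_ofFn.2 fun i j h => LVertex.xs.inj h)
      (List.nodup_ofFn.2 fun i j h => LVertex.zs.inj h) ?_
    simp [List.disjoint_left]
  have hm : ((LVertex.x : LVertex a b c) :: (List.ofFn LVertex.ys ++ List.ofFn LVertex.zs)).Nodup := by
    simp only [List.nodup_cons, List.mem_append, List.mem_ofFn, reduceCtorEq, exists_false,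
      or_self, not_false_eq_true, true_and]
    refine List.Nodup.append (List.nodup_ofFn.2 fun i j h => LVertex.ys.inj h)
      (List.nodup_ofFn.2 fun i j h => LVertex.zs.inj h) ?_
    simp [List.disjoint_left]
  rw [edgeIdeal_lyubeznikGraph]
  have hG := gluedResolution_isMinimalFree 𝕜 hxy hl hm
  refine ⟨⟨_, hG, gluedResolution_isGradedFree 𝕜 hxy hl hm⟩, fun F hF i => ?_, ?_⟩
  · rw [hF.finrank_eq hG, finrank_gluedResolution]
    simp only [List.length_append, List.length_ofFn]
    congr 2
    ring
  · rw [projectiveDimension_gluedIdeal hxy hl hm]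
    simp only [List.length_append, List.length_ofFn]
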